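/- Let $N\ge 2$, let $\mathcal H_1,\dots,\mathcal H_N$ be complex separable Hilbert spaces, let $\rho$ be a state (positive trace class operator of trace one) on the Hilbert space tensor product $\mathcal H_1\otimes\cdots\otimes\mathcal H_N$, and let $S_1,\dots,S_N\ge 1$ be integers. An $S_1\times\cdots\times S_N$-setting correlation scenario $\mathcal E$ with outcomes in $\Lambda=\Lambda_1\times\cdots\times\Lambda_N$ (each $\Lambda_n$ a standard Borel space) is a family of probability measures $P_{(s_1,\dots,s_N)}$ on $\Lambda$, $1\le s_n\le S_n$. It is a quantum scenario on $\rho$ if there are normalized positive operator-valued measures $\mathrm M_n^{(s_n)}$ on $\Lambda_n$, acting on $\mathcal H_n$, with $$P_{(s_1,\dots,s_N)}(F_1\times\cdots\times F_N)=\mathrm{tr}\big[\rho\{\mathrm M_1^{(s_1)}(F_1)\otimes\cdots\otimes \mathrm M_N^{(s_N)}(F_N)\}\big]$$ for all measurable $F_n\subseteq\Lambda_n$. It admits an LHV (local hidden variable) model if there are a probability space $(\Omega,\nu)$ and conditional probability measures $P_n^{(s_n)}(\cdot\mid\omega)$ on $\Lambda_n$, measurable in $\omega\in\Omega$, with $$P_{(s_1,\dots,s_N)}(F_1\times\cdots\times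 F_N)=\int_\Omega \prod_{n=1}^N P_n^{(s_n)}(F_n\mid\omega)\,\nu(\mathrm d\omega)$$ for all $s_1,\dots,s_N$ and all measurable $F_n\subseteq\Lambda_n$. Let $\gamma_{\mathcal E}$ be the infimum of the total variation norms of all normalized bounded real-valued measures on $\Lambda_1^{S_1}\times\cdots\times\Lambda_N^{S_N}$ that return all $P_{(s_1,\dots,s_N)}$ as the corresponding marginals, and let $\Upsilon^{(\rho)}_{S_1\times\cdots\times S_N}=\sup_\Lambda\sup_{\mathcal E}\gamma_{\mathcal E}$, where $\mathcal E$ runs over all quantum $S_1\times\cdots\times S_N$-setting scenarios on $\rho$ with outcomes in $\Lambda$. For a family $\Psi=\{\psi_{(s_1,\dots,s_N)}\}$ of bounded measurable real functions on $\Lambda$, put $\langle\Psi\rangle_{\mathcal E}=\sum_{s_1,\dots,s_N}\int_\Lambda\psi_{(s_1,\dots,s_N)}\,\mathrm dP_{(s_1,\dots,s_N)}$, and let $\mathcal B^{\sup}_\Psi$ and $\mathcal B^{\inf}_\Psi$ be the supremum and the infimum of $\langle\Psi\rangle_{\mathcal E}$ over all scenarios that admit an LHV model. The constraint $\mathcal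 B^{\inf}_\Psi\le\langle\Psi\rangle_{\mathcal E}\le\mathcal B^{\sup}_\Psi$ is called a Bell-type inequality if it is violated by some scenario that admits no LHV model. The following statements are mutually equivalent: (a) $\rho$ admits the $S_1\times\cdots\times S_N$-setting LHV description, that is, every quantum $S_1\times\cdots\times S_N$-setting scenario on $\rho$, with arbitrary positive operator-valued measures and arbitrary outcome sets $\Lambda$, admits an LHV model; (b) $\Upsilon^{(\rho)}_{S_1\times\cdots\times S_N}=1$; (c) $\rho$ violates no Bell-type inequality with settings $1\le L_1\le S_1,\dots,1\le L_N\le S_N$ and outcomes in an arbitrary set $\Lambda$, that is, no quantum $L_1\times\cdots\times L_N$-setting scenario on $\rho$ violates such an inequality. -/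

import Mathlib

open scoped TensorProduct InnerProductSpace ENNReal ComplexConjugate
open MeasureTheory ProbabilityTheory

universe u

/-! ## Hilbert tensor product of finitely many Hilbert spaces -/

section HilbertTensor

variable {N : ℕ}

/-- The algebraic tensor product `H₁ ⊗ ⋯ ⊗ H_N`, as a type of its own so that it can carry the
Hilbert tensor inner product. -/
def AlgTensor (H : Fin N → Type u) [∀ n, NormedAddCommGroup (H n)]
    [∀ n, InnerProductSpace ℂ (H n)] : Type u := ⨂[ℂ] n, H n

variable (H : Fin N → Type u) [∀ n, NormedAddCommGroup (H n)] [∀ n, InnerProductSpace ℂ (H n)]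

noncomputable instance AlgTensor.instAddCommGroup : AddCommGroup (AlgTensor H) :=
  inferInstanceAs (AddCommGroup (⨂[ℂ] n, H n))

noncomputable instance AlgTensor.instModule : Module ℂ (AlgTensor H) :=
  inferInstanceAs (Module ℂ (⨂[ℂ] n, H n))

namespace AlgTensor

variable {H}

/-- The elementary tensor `x₁ ⊗ ⋯ ⊗ x_N`. -/
noncomputable def pure (x : ∀ n, H n) : AlgTensor H := PiTensorProduct.tprod ℂ x

theorem span_pure : Submodule.span ℂ (Set.range (pure (H := H))) = ⊤ :=
  PiTensorProduct.span_tprod_eq_top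

/-- The linear functional `t ↦ ⟪x₁ ⊗ ⋯ ⊗ x_N, t⟫`. -/
noncomputable def innerPure (x : ∀ n, H n) : AlgTensor H →ₗ[ℂ] ℂ :=
  PiTensorProduct.lift ((MultilinearMap.mkPiAlgebra ℂ (Fin N) ℂ).compLinearMap
    (fun n => (innerSL ℂ (x n)).toLinearMap))

theorem innerPure_pure (x y : ∀ n, H n) : innerPure x (pure y) = ∏ n, ⟪x n, y n⟫_ℂ := by
  refine (PiTensorProduct.lift.tprod (R := ℂ) y).trans ?_
  simp

theorem ext_pure {E : Type*} [AddCommGroup E] [Module ℂ E] {f g : AlgTensor H →ₗ[ℂ] E}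
    (h : ∀ x, f (pure x) = g (pure x)) : f = g :=
  LinearMap.ext_on_range span_pure h

theorem innerPure_update_add (x : ∀ n, H n) (n : Fin N) (a b : H n) :
    innerPure (Function.update x n (a + b)) =
      innerPure (Function.update x n a) + innerPure (Function.update x n b) := by
  refine ext_pure fun y => ?_
  have h : ∀ c : H n, (innerPure (Function.update x n c) (pure y) : ℂ) =
      ⟪c, y n⟫_ℂ * ∏ m ∈ Finset.univ.erase n, ⟪x m, y m⟫_ℂ := by
    intro c
    rw [innerPure_pure, ← Finset.mul_prod_erase _ _ (Finset.mem_univ n)]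
    congr 1
    · simp
    · refine Finset.prod_congr rfl fun m hm => ?_
      rw [Function.update_of_ne (Finset.ne_of_mem_erase hm)]
  rw [LinearMap.add_apply, h, h, h, inner_add_left, add_mul]

theorem innerPure_update_smul (x : ∀ n, H n) (n : Fin N) (r : ℂ) (a : H n) :
    innerPure (Function.update x n (r • a)) =
      (starRingEnd ℂ r) • innerPure (Function.update x n a) := by
  refine ext_pure fun y => ?_
  have h : ∀ c : H n, (innerPure (Function.update x n c) (pure y) : ℂ) =
      ⟪c, y n⟫_ℂ * ∏ m ∈ Finset.univ.erase n, ⟪x m, y m⟫_ℂ := by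
    intro c
    rw [innerPure_pure, ← Finset.mul_prod_erase _ _ (Finset.mem_univ n)]
    congr 1
    · simp
    · refine Finset.prod_congr rfl fun m hm => ?_
      rw [Function.update_of_ne (Finset.ne_of_mem_erase hm)]
  rw [LinearMap.smul_apply, h, h, inner_smul_left, smul_eq_mul, mul_assoc]

/-- `x ↦ (t ↦ ⟪t, x₁ ⊗ ⋯ ⊗ x_N⟫)` as a multilinear map. -/
noncomputable def flipInner : MultilinearMap ℂ H (AlgTensor H →ₗ⋆[ℂ] ℂ) where
  toFun x := (starLinearEquiv ℂ (A := ℂ)).toLinearMap.comp (innerPure x)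
  map_update_add' := by
    intro _ x n a b
    obtain rfl := Subsingleton.elim ‹DecidableEq (Fin N)› (instDecidableEqFin N)
    ext t
    simp [innerPure_update_add]
  map_update_smul' := by
    intro _ x n r a
    obtain rfl := Subsingleton.elim ‹DecidableEq (Fin N)› (instDecidableEqFin N)
    ext t
    simp [innerPure_update_smul]

/-- `t ↦ (s ↦ ⟪s, t⟫)`: linear in `t`, conjugate linear in `s`, with
`⟪x₁ ⊗ ⋯ ⊗ x_N, y₁ ⊗ ⋯ ⊗ y_N⟫ = ⟪x₁, y₁⟫ ⋯ ⟪x_N, y_N⟫`. -/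
noncomputable def innerForm : AlgTensor H →ₗ[ℂ] AlgTensor H →ₗ⋆[ℂ] ℂ :=
  PiTensorProduct.lift flipInner

theorem innerForm_pure_right (t : AlgTensor H) (y : ∀ n, H n) :
    innerForm (pure y) t = star (innerPure y t) :=
  congrArg (fun f : AlgTensor H →ₗ⋆[ℂ] ℂ => f t)
    (PiTensorProduct.lift.tprod (R := ℂ) (φ := flipInner) y)

theorem innerForm_pure (x y : ∀ n, H n) :
    innerForm (pure y) (pure x) = ∏ n, ⟪x n, y n⟫_ℂ := by
  rw [innerForm_pure_right, innerPure_pure]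
  simp

@[elab_as_elim]
theorem induction_pure {p : AlgTensor H → Prop} (t : AlgTensor H) (h0 : p 0)
    (hp : ∀ x, p (pure x)) (ha : ∀ s t, p s → p t → p (s + t))
    (hs : ∀ (c : ℂ) t, p t → p (c • t)) : p t := by
  have ht : t ∈ Submodule.span ℂ (Set.range (pure (H := H))) := by rw [span_pure]; trivial
  induction ht using Submodule.span_induction with
  | mem x hx => obtain ⟨x, rfl⟩ := hx; exact hp x
  | zero => exact h0
  | add x y _ _ hx hy => exact ha x y hx hy
  | smul c x _ hx => exact hs c x hx

theorem innerForm_symm (s t : AlgTensor H) :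
    starRingEnd ℂ (innerForm s t) = innerForm t s := by
  induction s using induction_pure with
  | h0 => simp
  | ha a b ha hb => simp [ha, hb]
  | hs c a ha => simp [ha]
  | hp x =>
    induction t using induction_pure with
    | h0 => simp
    | ha a b ha hb => rw [map_add, map_add, ha, hb, map_add, LinearMap.add_apply]
    | hs c a ha => simp [ha]
    | hp y => simp [innerForm_pure]

/-- Every tensor is a combination of products of orthonormal vectors. -/
theorem exists_orthonormal_expansion (t : AlgTensor H) :
    ∃ (d : Fin N → ℕ) (e : ∀ n, Fin (d n) → H n) (c : (∀ n, Fin (d n)) → ℂ),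
      (∀ n, Orthonormal ℂ (e n)) ∧ t = ∑ i, c i • pure (fun n => e n (i n)) := by
  have ht : t ∈ Submodule.span ℂ (Set.range (pure (H := H))) := by rw [span_pure]; trivial
  obtain ⟨c, rfl⟩ := (Finsupp.mem_span_range_iff_exists_finsupp).1 ht
  classical
  let V : ∀ n, Submodule ℂ (H n) := fun n =>
    Submodule.span ℂ ((c.support.image fun x : ∀ n, H n => x n : Finset (H n)) : Set (H n))
  have hV : ∀ x ∈ c.support, ∀ n, x n ∈ V n := fun x hx n =>
    Submodule.subset_span (by
      rw [Finset.coe_image]; exact ⟨x, hx, rfl⟩)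
  have : ∀ n, FiniteDimensional ℂ (V n) := fun n => FiniteDimensional.span_finset ℂ _
  let b : ∀ n, OrthonormalBasis (Fin (Module.finrank ℂ (V n))) ℂ (V n) := fun n =>
    stdOrthonormalBasis ℂ (V n)
  refine ⟨fun n => Module.finrank ℂ (V n), fun n k => (b n k : H n),
    fun i => ∑ x ∈ c.support, c x * ∏ n, ⟪(b n (i n) : H n), x n⟫_ℂ, fun n => ?_, ?_⟩
  · exact (b n).orthonormal.comp_linearIsometry (V n).subtypeₗᵢ
  · have key : ∀ x ∈ c.support, pure x =
        ∑ i : ∀ n, Fin (Module.finrank ℂ (V n)),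
          (∏ n, ⟪(b n (i n) : H n), x n⟫_ℂ) • pure (fun n => (b n (i n) : H n)) := by
      intro x hx
      have hx' : x = fun n => ∑ k, ⟪(b n k : H n), x n⟫_ℂ • (b n k : H n) := by
        funext n
        have := (b n).sum_repr' ⟨x n, hV x hx n⟩
        have := congrArg (Subtype.val) this
        simpa using this.symm
      conv_lhs => rw [hx']
      refine (MultilinearMap.map_sum (PiTensorProduct.tprod ℂ) _).trans ?_
      refine Finset.sum_congr rfl fun i _ => ?_
      exact MultilinearMap.map_smul_univ (PiTensorProduct.tprod ℂ) _ _
    rw [Finsupp.sum]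
    simp_rw [Finset.sum_smul]
    rw [Finset.sum_comm]
    refine Finset.sum_congr rfl fun x hx => ?_
    conv_lhs => rw [key x hx]
    rw [Finset.smul_sum]
    simp_rw [smul_smul]

theorem innerForm_self (d : Fin N → ℕ) (e : ∀ n, Fin (d n) → H n)
    (he : ∀ n, Orthonormal ℂ (e n)) (c : (∀ n, Fin (d n)) → ℂ) :
    innerForm (∑ i, c i • pure (fun n => e n (i n))) (∑ i, c i • pure (fun n => e n (i n))) =
      ((∑ i, ‖c i‖ ^ 2 : ℝ) : ℂ) := by
  have h : ∀ i j : ∀ n, Fin (d n),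
      innerForm (pure fun n => e n (i n)) (pure fun n => e n (j n)) = if i = j then 1 else 0 := by
    intro i j
    rw [innerForm_pure]
    simp_rw [orthonormal_iff_ite.1 (he _)]
    split_ifs with hij
    · subst hij; simp
    · obtain ⟨n, hn⟩ := Function.ne_iff.1 hij
      exact Finset.prod_eq_zero (Finset.mem_univ n) (if_neg (Ne.symm hn))
  simp only [map_sum, map_smul, LinearMap.sum_apply, LinearMap.smul_apply, map_smulₛₗ, h]
  simp [Complex.conj_mul']

/-- The inner product of the algebraic tensor product. -/
@[reducible]
noncomputable def innerCore : InnerProductSpace.Core ℂ (AlgTensor H) where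
  inner s t := innerForm t s
  conj_inner_symm s t := innerForm_symm _ _
  re_inner_nonneg t := by
    obtain ⟨d, e, c, he, rfl⟩ := exists_orthonormal_expansion t
    rw [innerForm_self d e he c]
    simp only [RCLike.re_to_complex, Complex.ofReal_re]
    positivity
  add_left s t u := by simp
  smul_left s t c := by simp
  definite t ht := by
    obtain ⟨d, e, c, he, rfl⟩ := exists_orthonormal_expansion t
    change innerForm _ _ = 0 at ht
    rw [innerForm_self d e he c, Complex.ofReal_eq_zero,
      Finset.sum_eq_zero_iff_of_nonneg (fun _ _ => by positivity)] at ht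
    refine Finset.sum_eq_zero fun i hi => ?_
    have : c i = 0 := by simpa using ht i hi
    rw [this, zero_smul]

noncomputable instance : NormedAddCommGroup (AlgTensor H) :=
  innerCore.toNormedAddCommGroup

noncomputable instance : InnerProductSpace ℂ (AlgTensor H) :=
  InnerProductSpace.ofCore innerCore.toCore

theorem inner_pure (x y : ∀ n, H n) : ⟪pure x, pure y⟫_ℂ = ∏ n, ⟪x n, y n⟫_ℂ :=
  innerForm_pure x y

/-! ### Tensor products of operators -/

/-- `X₁ ⊗ ⋯ ⊗ X_N` on the algebraic tensor product. -/
noncomputable def mapₗ (X : ∀ n, H n →L[ℂ] H n) : AlgTensor H →ₗ[ℂ] AlgTensor H :=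
  PiTensorProduct.map fun n => (X n).toLinearMap

theorem mapₗ_pure (X : ∀ n, H n →L[ℂ] H n) (x : ∀ n, H n) :
    mapₗ X (pure x) = pure fun n => X n (x n) :=
  PiTensorProduct.map_tprod _ _

theorem mapₗ_mapₗ (X Y : ∀ n, H n →L[ℂ] H n) (t : AlgTensor H) :
    mapₗ X (mapₗ Y t) = mapₗ (fun n => X n * Y n) t := by
  have : (mapₗ X).comp (mapₗ Y) = mapₗ (fun n => X n * Y n) :=
    ext_pure fun x => by simp [mapₗ_pure]
  exact LinearMap.congr_fun this t

theorem mapₗ_one : mapₗ (H := H) (fun _ => 1) = LinearMap.id :=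
  ext_pure fun x => by simp [mapₗ_pure]

theorem mapₗ_update_add (X : ∀ n, H n →L[ℂ] H n) (n : Fin N) (A B : H n →L[ℂ] H n) :
    mapₗ (Function.update X n (A + B)) =
      mapₗ (Function.update X n A) + mapₗ (Function.update X n B) := by
  refine ext_pure fun x => ?_
  have h : ∀ C : H n →L[ℂ] H n, mapₗ (Function.update X n C) (pure x) =
      pure (Function.update (fun m => X m (x m)) n (C (x n))) := by
    intro C
    rw [mapₗ_pure]
    congr 1
    funext m
    rcases eq_or_ne m n with rfl | hm
    · simp
    · simp [hm]
  rw [LinearMap.add_apply, h, h, h]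
  exact MultilinearMap.map_update_add (PiTensorProduct.tprod ℂ) _ _ _ _

theorem mapₗ_update_smul (X : ∀ n, H n →L[ℂ] H n) (n : Fin N) (r : ℂ) (A : H n →L[ℂ] H n) :
    mapₗ (Function.update X n (r • A)) = r • mapₗ (Function.update X n A) := by
  refine ext_pure fun x => ?_
  have h : ∀ C : H n →L[ℂ] H n, mapₗ (Function.update X n C) (pure x) =
      pure (Function.update (fun m => X m (x m)) n (C (x n))) := by
    intro C
    rw [mapₗ_pure]
    congr 1
    funext m
    rcases eq_or_ne m n with rfl | hm
    · simp
    · simp [hm]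
  rw [LinearMap.smul_apply, h, h]
  exact MultilinearMap.map_update_smul (PiTensorProduct.tprod ℂ) _ _ _ _

/-- `1 ⊗ ⋯ ⊗ A ⊗ ⋯ ⊗ 1`, as a family of operators. -/
noncomputable def site (n : Fin N) (A : H n →L[ℂ] H n) : ∀ m, H m →L[ℂ] H m :=
  Function.update (fun _ => 1) n A

@[simp] theorem site_self (n : Fin N) (A : H n →L[ℂ] H n) : site n A n = A := by simp [site]

@[simp] theorem site_of_ne {n m : Fin N} (h : m ≠ n) (A : H n →L[ℂ] H n) : site n A m = 1 := by
  simp [site, h]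

variable [∀ n, CompleteSpace (H n)]

theorem inner_mapₗ (X : ∀ n, H n →L[ℂ] H n) (s t : AlgTensor H) :
    ⟪mapₗ X s, t⟫_ℂ = ⟪s, mapₗ (fun n => star (X n)) t⟫_ℂ := by
  induction s using induction_pure with
  | h0 => simp
  | ha a b ha hb => simp only [map_add, inner_add_left, ha, hb]
  | hs c a ha => simp only [map_smul, inner_smul_left, ha]
  | hp x =>
    induction t using induction_pure with
    | h0 => simp
    | ha a b ha hb => simp only [map_add, inner_add_right, ha, hb]
    | hs c a ha => simp only [map_smul, inner_smul_right, ha]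
    | hp y =>
      rw [mapₗ_pure, mapₗ_pure, inner_pure, inner_pure]
      simp [ContinuousLinearMap.star_eq_adjoint, ContinuousLinearMap.adjoint_inner_right]

/-- `1 ⊗ ⋯ ⊗ A ⊗ ⋯ ⊗ 1` is bounded by `‖A‖`. -/
theorem norm_site_le (n : Fin N) (A : H n →L[ℂ] H n) (t : AlgTensor H) :
    ‖mapₗ (site n A) t‖ ≤ ‖A‖ * ‖t‖ := by
  have hstar : ∀ B : H n →L[ℂ] H n,
      ⟪t, mapₗ (site n (star B * B)) t⟫_ℂ =
        ((‖mapₗ (site n B) t‖ ^ 2 : ℝ) : ℂ) := by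
    intro B
    have e1 : (fun m => star (site n B m)) =
        site n (star B) := by
      funext m
      rcases eq_or_ne m n with rfl | hm
      · simp
      · simp [hm]
    have e2 : (fun m => (site n (star B) m *
        site n B m : H m →L[ℂ] H m)) =
        site n (star B * B) := by
      funext m
      rcases eq_or_ne m n with rfl | hm
      · simp
      · simp [hm]
    have := inner_mapₗ (site n B) t
      (mapₗ (site n B) t)
    rw [e1, mapₗ_mapₗ, e2, inner_self_eq_norm_sq_to_K] at this
    rw [← this]; simp
  have hpos : 0 ≤ algebraMap ℝ (H n →L[ℂ] H n) (‖A‖ ^ 2) - star A * A :=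
    sub_nonneg.2 CStarAlgebra.star_mul_le_algebraMap_norm_sq
  obtain ⟨B, hB⟩ := CStarAlgebra.nonneg_iff_eq_star_mul_self.1 hpos
  have hsum : star A * A + star B * B = ((‖A‖ ^ 2 : ℝ) : ℂ) • 1 := by
    rw [← hB, add_sub_cancel, Algebra.algebraMap_eq_smul_one]
    exact (Complex.coe_smul _ _).symm
  have h1 : site n (1 : H n →L[ℂ] H n) = fun _ => 1 := by simp [site]
  have h2 : ∀ C D : H n →L[ℂ] H n, mapₗ (site n (C + D)) = mapₗ (site n C) + mapₗ (site n D) :=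
    mapₗ_update_add _ n
  have h3 : ∀ (c : ℂ) (C : H n →L[ℂ] H n), mapₗ (site n (c • C)) = c • mapₗ (site n C) :=
    mapₗ_update_smul _ n
  have hk := congrArg (fun C => ⟪t, mapₗ (site n C) t⟫_ℂ) hsum
  simp only [h2, h3, LinearMap.add_apply, inner_add_right, hstar,
    h1, mapₗ_one, LinearMap.smul_apply, inner_smul_right, LinearMap.id_apply,
    inner_self_eq_norm_sq_to_K] at hk
  have hk' : ‖mapₗ (site n A) t‖ ^ 2 +
      ‖mapₗ (site n B) t‖ ^ 2 = ‖A‖ ^ 2 * ‖t‖ ^ 2 := by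
    refine Complex.ofReal_injective ?_
    push_cast at hk ⊢
    simpa using hk
  refine le_of_sq_le_sq ?_ (by positivity)
  rw [mul_pow, ← hk']
  exact le_add_of_nonneg_right (by positivity)

theorem norm_mapₗ_le (X : ∀ n, H n →L[ℂ] H n) (t : AlgTensor H) :
    ‖mapₗ X t‖ ≤ (∏ n, ‖X n‖) * ‖t‖ := by
  have key : ∀ s : Finset (Fin N),
      ‖mapₗ (fun n => if n ∈ s then X n else 1) t‖ ≤ (∏ n ∈ s, ‖X n‖) * ‖t‖ := by
    intro s
    induction s using Finset.induction_on with
    | empty => simp [mapₗ_one]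
    | insert a s ha ih =>
      have e : (fun n => if n ∈ insert a s then X n else 1) = fun n =>
          site a (X a) n * (if n ∈ s then X n else 1) := by
        funext n
        rcases eq_or_ne n a with rfl | hn
        · simp [ha]
        · simp [hn]
      rw [e, ← mapₗ_mapₗ, Finset.prod_insert ha, mul_assoc]
      exact (norm_site_le a (X a) _).trans (by gcongr)
  simpa using key Finset.univ

/-- `X₁ ⊗ ⋯ ⊗ X_N` as a bounded operator on the algebraic tensor product. -/
noncomputable def mapL (X : ∀ n, H n →L[ℂ] H n) : AlgTensor H →L[ℂ] AlgTensor H :=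
  (mapₗ X).mkContinuous (∏ n, ‖X n‖) (norm_mapₗ_le X)

end AlgTensor

/-- The Hilbert space tensor product `H₁ ⊗ ⋯ ⊗ H_N`: the completion of the algebraic tensor product
for the inner product with `⟪x₁ ⊗ ⋯ ⊗ x_N, y₁ ⊗ ⋯ ⊗ y_N⟫ = ⟪x₁, y₁⟫ ⋯ ⟪x_N, y_N⟫`. -/
abbrev HilbertTensor : Type u := UniformSpace.Completion (AlgTensor H)

variable {H}

/-- The bounded operator `X₁ ⊗ ⋯ ⊗ X_N` on `H₁ ⊗ ⋯ ⊗ H_N`. -/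
noncomputable def tensorOp [∀ n, CompleteSpace (H n)] (X : ∀ n, H n →L[ℂ] H n) :
    HilbertTensor H →L[ℂ] HilbertTensor H :=
  (AlgTensor.mapL X).completion

theorem tensorOp_pure [∀ n, CompleteSpace (H n)] (X : ∀ n, H n →L[ℂ] H n) (x : ∀ n, H n) :
    tensorOp X (AlgTensor.pure x : HilbertTensor H) =
      (AlgTensor.pure fun n => X n (x n) : AlgTensor H) := by
  rw [tensorOp, ContinuousLinearMap.completion_apply_coe]
  exact congrArg _ (AlgTensor.mapₗ_pure X x)

end HilbertTensor

/-! ## States, POV measures -/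

section Quantum

/-- `T` has trace `τ`: the diagonal sums of `T` converge unconditionally to `τ` in every orthonormal
basis. A bounded operator has a trace in this sense exactly if it is of trace class. -/
def HasTrace {K : Type u} [NormedAddCommGroup K] [InnerProductSpace ℂ K] (T : K →L[ℂ] K) (τ : ℂ) :
    Prop :=
  ∀ (ι : Type u) (b : HilbertBasis ι ℂ K), HasSum (fun i => ⟪b i, T (b i)⟫_ℂ) τ

/-- A quantum state: a positive (trace class) operator of trace one. -/
structure IsState {K : Type u} [NormedAddCommGroup K] [InnerProductSpace ℂ K] (ρ : K →L[ℂ] K) :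
    Prop where
  isPositive : ρ.IsPositive
  hasTrace : HasTrace ρ 1

/-- A normalized positive operator-valued measure on `Λ` with values on the Hilbert space `E`.
Values on nonmeasurable sets play no role. -/
structure POVM (Λ : Type) [MeasurableSpace Λ] (E : Type u) [NormedAddCommGroup E]
    [InnerProductSpace ℂ E] where
  toFun : Set Λ → (E →L[ℂ] E)
  isPositive : ∀ F, MeasurableSet F → (toFun F).IsPositive
  map_univ : toFun Set.univ = 1
  hasSum_iUnion : ∀ F : ℕ → Set Λ, (∀ k, MeasurableSet (F k)) → Pairwise (Function.onFun Disjoint F) →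
    ∀ x, HasSum (fun k => toFun (F k) x) (toFun (⋃ k, F k) x)

end Quantum

/-! ## Correlation scenarios and hidden variable models -/

section Scenario

variable {N : ℕ}

/-- An `S₁ × ⋯ × S_N`-setting correlation scenario with outcomes in `Λ₁ × ⋯ × Λ_N`: a joint
probability distribution for every choice `(s₁, …, s_N)` of one measurement at each site. -/
structure CorrelationScenario (S : Fin N → ℕ) (Λ : Fin N → Type) [∀ n, MeasurableSpace (Λ n)] where
  P : (∀ n, Fin (S n)) → Measure (∀ n, Λ n)
  isProbabilityMeasure : ∀ s, IsProbabilityMeasure (P s)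

namespace CorrelationScenario

variable {S : Fin N → ℕ} {Λ : Fin N → Type} [∀ n, MeasurableSpace (Λ n)]

/-- The scenario admits a local hidden variable (LHV) model. -/
def AdmitsLHV (E : CorrelationScenario S Λ) : Prop :=
  ∃ (Ω : Type) (_ : MeasurableSpace Ω) (ν : Measure Ω) (κ : ∀ n, Fin (S n) → Kernel Ω (Λ n)),
    IsProbabilityMeasure ν ∧ (∀ n s, IsMarkovKernel (κ n s)) ∧
    ∀ (s : ∀ n, Fin (S n)) (F : ∀ n, Set (Λ n)), (∀ n, MeasurableSet (F n)) →
      E.P s (Set.pi Set.univ F) = ∫⁻ ω, ∏ n, κ n (s n) ω (F n) ∂ν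

/-- `μ` is a normalized real-valued measure on `Λ₁^{S₁} × ⋯ × Λ_N^{S_N}` returning all joint
distributions of the scenario as marginals. -/
def IsSimulatedBy (E : CorrelationScenario S Λ)
    (μ : SignedMeasure (∀ n, Fin (S n) → Λ n)) : Prop :=
  μ Set.univ = 1 ∧
  ∀ (s : ∀ n, Fin (S n)) (F : Set (∀ n, Λ n)), MeasurableSet F →
    μ ((fun ω n => ω n (s n)) ⁻¹' F) = (E.P s).real F

/-- The scenario parameter `γ`: the infimum of the total variation norms of the normalized
real-valued measures simulating the scenario. -/
noncomputable def gamma (E : CorrelationScenario S Λ) : ℝ≥0∞ :=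
  ⨅ (μ : SignedMeasure (∀ n, Fin (S n) → Λ n)) (_ : E.IsSimulatedBy μ),
    μ.totalVariation Set.univ

/-- `E` is the correlation scenario of the state `ρ` under the POV measures `M n s`:
`P_{(s₁,…,s_N)}(F₁ × ⋯ × F_N) = tr[ρ (M₁^{(s₁)}(F₁) ⊗ ⋯ ⊗ M_N^{(s_N)}(F_N))]`.The joint distributions are
determined by their values on measurable rectangles. -/
def IsQuantum {H : Fin N → Type u} [∀ n, NormedAddCommGroup (H n)]
    [∀ n, InnerProductSpace ℂ (H n)] [∀ n, CompleteSpace (H n)]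
    (E : CorrelationScenario S Λ) (ρ : HilbertTensor H →L[ℂ] HilbertTensor H)
    (M : ∀ n, Fin (S n) → POVM (Λ n) (H n)) : Prop :=
  ∀ (s : ∀ n, Fin (S n)) (F : ∀ n, Set (Λ n)), (∀ n, MeasurableSet (F n)) →
    HasTrace (ρ ∘L tensorOp fun n => (M n (s n)).toFun (F n))
      ((E.P s).real (Set.pi Set.univ F) : ℂ)

end CorrelationScenario

/-! ## Bell-type inequalities -/

/-- A family of bounded measurable real-valued functions on `Λ₁ × ⋯ × Λ_N`, one for every joint
measurement `(s₁, …, s_N)`. -/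
structure BellFamily (S : Fin N → ℕ) (Λ : Fin N → Type) [∀ n, MeasurableSpace (Λ n)] where
  ψ : (∀ n, Fin (S n)) → (∀ n, Λ n) → ℝ
  measurable : ∀ s, Measurable (ψ s)
  bounded : ∀ s, ∃ C, ∀ l, |ψ s l| ≤ C

namespace BellFamily

variable {S : Fin N → ℕ} {Λ : Fin N → Type} [∀ n, MeasurableSpace (Λ n)]

/-- The linear combination of averages `∑ ⟨ψ_{(s₁,…,s_N)}⟩` in a scenario. -/
noncomputable def value (Ψ : BellFamily S Λ) (E : CorrelationScenario S Λ) : ℝ :=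
  ∑ s, ∫ l, Ψ.ψ s l ∂(E.P s)

/-- The LHV constant `B^sup`: the supremum over all LHV scenarios. -/
noncomputable def lhvSup (Ψ : BellFamily S Λ) : ℝ :=
  sSup (Ψ.value '' {E | E.AdmitsLHV})

/-- The LHV constant `B^inf`: the infimum over all LHV scenarios. -/
noncomputable def lhvInf (Ψ : BellFamily S Λ) : ℝ :=
  sInf (Ψ.value '' {E | E.AdmitsLHV})

/-- The scenario violates the tight LHV constraint `B^inf ≤ ∑ ⟨ψ⟩ ≤ B^sup`. -/
def IsViolatedBy (Ψ : BellFamily S Λ) (E : CorrelationScenario S Λ) : Prop :=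
  ¬ (Ψ.lhvInf ≤ Ψ.value E ∧ Ψ.value E ≤ Ψ.lhvSup)

/-- The tight LHV constraint of `Ψ` is a Bell-type inequality: it is violated in some non-LHV
correlation scenario. -/
def IsBellType (Ψ : BellFamily S Λ) : Prop :=
  ∃ E : CorrelationScenario S Λ, ¬ E.AdmitsLHV ∧ Ψ.IsViolatedBy E

end BellFamily

/-! ## The three properties of a state

Outcome spaces are standard Borel, hence isomorphic to Borel subsets of `ℝ`, so that it is enough to
let them range over `Type`. -/

variable {H : Fin N → Type u} [∀ n, NormedAddCommGroup (H n)]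
    [∀ n, InnerProductSpace ℂ (H n)] [∀ n, CompleteSpace (H n)]

/-- The state `ρ` admits the `S₁ × ⋯ × S_N`-setting LHV description: every quantum
`S₁ × ⋯ × S_N`-setting scenario on `ρ`, with arbitrary outcome sets and POV measures, admits an LHV
model. -/
def AdmitsLHVDescription (ρ : HilbertTensor H →L[ℂ] HilbertTensor H) (S : Fin N → ℕ) : Prop :=
  ∀ (Λ : Fin N → Type) [∀ n, MeasurableSpace (Λ n)] [∀ n, StandardBorelSpace (Λ n)]
    (M : ∀ n, Fin (S n) → POVM (Λ n) (H n)) (E : CorrelationScenario S Λ),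
    E.IsQuantum ρ M → E.AdmitsLHV

/-- The state parameter `Υ^{(ρ,Λ)}`: the supremum of `γ` over all quantum scenarios on `ρ` with
outcomes in `Λ`. -/
noncomputable def upsilonOn (ρ : HilbertTensor H →L[ℂ] HilbertTensor H) (S : Fin N → ℕ)
    (Λ : Fin N → Type) [∀ n, MeasurableSpace (Λ n)] : ℝ≥0∞ :=
  ⨆ (M : ∀ n, Fin (S n) → POVM (Λ n) (H n)) (E : CorrelationScenario S Λ) (_ : E.IsQuantum ρ M),
    E.gamma

/-- The state parameter `Υ^{(ρ)}`: the supremum of `Υ^{(ρ,Λ)}` over all outcome sets. -/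
noncomputable def upsilon (ρ : HilbertTensor H →L[ℂ] HilbertTensor H) (S : Fin N → ℕ) : ℝ≥0∞ :=
  ⨆ (Λ : Fin N → Type) (_ : ∀ n, MeasurableSpace (Λ n)) (_ : ∀ n, StandardBorelSpace (Λ n)),
    upsilonOn ρ S Λ

/-- The state `ρ` violates some Bell-type inequality with `L₁ × ⋯ × L_N` settings, for some
`1 ≤ Lₙ ≤ Sₙ`, and outcomes in some set. -/
def ViolatesBellType (ρ : HilbertTensor H →L[ℂ] HilbertTensor H) (S : Fin N → ℕ) : Prop :=
  ∃ (L : Fin N → ℕ) (_ : ∀ n, 1 ≤ L n ∧ L n ≤ S n)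
    (Λ : Fin N → Type) (_ : ∀ n, MeasurableSpace (Λ n)) (_ : ∀ n, StandardBorelSpace (Λ n))
    (Ψ : BellFamily L Λ) (M : ∀ n, Fin (L n) → POVM (Λ n) (H n)) (E : CorrelationScenario L Λ),
    Ψ.IsBellType ∧ E.IsQuantum ρ M ∧ Ψ.IsViolatedBy E

end Scenario

/-! An LHV model amounts to a probability measure on the assignments of outcomes to all settings at
all sites, with the given joint distributions as marginals: draw all outcomes independently given
the hidden variable, or conversely take the assignment itself as hidden variable. Such a measure is
a positive simulating measure, so it has total variation 1, the least value possible; hence (a)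
gives (b), and an LHV scenario violates no tight LHV constraint.

Both converses rest on one separation result, `admitsLHV_of_value_le`: a scenario obeying every
linear inequality valid for deterministic assignments has such a joint measure. It comes from
Hahn-Banach and Riesz-Markov on a power of the unit interval, into which the outcomes are embedded
measurably. If `γ ≤ 1`, simulating measures with negative part of arbitrarily small mass yield these
inequalities up to any `δ`. If no Bell-type inequality is violated, they hold because the LHV
supremum never exceeds a deterministic bound. Smaller numbers of settings reduce to `S` by repeating
settings. -/

/-- A linear functional `φ` on `V` with `φ v ≤ sup (A v)`, the supremum being over a nonempty family
of points of a compact space `X`, is represented by a probability measure on `X`. -/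
theorem exists_isProbabilityMeasure_of_le_sup {X Q V : Type*} [TopologicalSpace X] [CompactSpace X]
    [T2Space X] [MeasurableSpace X] [BorelSpace X] [Nonempty Q] [AddCommGroup V] [Module ℝ V]
    (j : Q → X) (A : V →ₗ[ℝ] C(X, ℝ)) (φ : V →ₗ[ℝ] ℝ)
    (h : ∀ v B, (∀ q, A v (j q) ≤ B) → φ v ≤ B) :
    ∃ μ : Measure X, IsProbabilityMeasure μ ∧ ∀ v, ∫ x, A v x ∂μ = φ v := by
  have hbdd : ∀ g : C(X, ℝ), BddAbove (Set.range fun q => g (j q)) := fun g =>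
    ⟨‖g‖, by rintro _ ⟨q, rfl⟩; exact (le_abs_self _).trans (g.norm_coe_le_norm (j q))⟩
  have hker : ∀ v, A v = 0 → φ v = 0 := fun v hv => by
    refine le_antisymm (h v 0 fun q => by simp [hv]) ?_
    have := h (-v) 0 fun q => by simp [hv]
    simpa using this
  -- By `hker`, `φ` descends to the range of `A`; with a linear section `σ` the descended functional
  -- is `φ ∘ₗ σ`.
  obtain ⟨σ, hσ⟩ := A.rangeRestrict.exists_rightInverse_of_surjective A.range_rangeRestrict
  have hφσ : ∀ v, φ (σ (A.rangeRestrict v)) = φ v := fun v => by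
    rw [← sub_eq_zero, ← map_sub]
    refine hker _ ?_
    have := congrArg Subtype.val (LinearMap.congr_fun hσ (A.rangeRestrict v))
    rw [map_sub, sub_eq_zero]
    simpa using this
  -- Hahn-Banach, dominated by the sublinear functional `g ↦ ⨆ q, g (j q)`. Domination at `-g` makes
  -- the extension positive, and domination at `±1` makes it normalized, so Riesz-Markov applies.
  obtain ⟨T, hT, hTle⟩ := exists_extension_of_le_sublinear
    (⟨LinearMap.range A, φ ∘ₗ σ⟩ : C(X, ℝ) →ₗ.[ℝ] ℝ) (fun g => ⨆ q, g (j q))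
    (fun c hc g => by
      simp only [ContinuousMap.coe_smul, Pi.smul_apply, smul_eq_mul]
      exact (Real.mul_iSup_of_nonneg hc.le _).symm)
    (fun f g => ciSup_le fun q => add_le_add (le_ciSup (hbdd f) q) (le_ciSup (hbdd g) q))
    (by
      rintro ⟨_, v, rfl⟩
      exact (hφσ v).trans_le (h v _ fun q => le_ciSup (hbdd (A v)) q))
  have hTpos : ∀ g : C(X, ℝ), 0 ≤ g → 0 ≤ T g := fun g hg => by
    have := (hTle (-g)).trans (ciSup_le (c := 0) fun q => by simpa using hg (j q))
    simpa using this
  have hT1 : T 1 = 1 := by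
    refine le_antisymm ((hTle 1).trans (by simp)) ?_
    have := hTle (-1)
    simp only [map_neg, ContinuousMap.neg_apply, ContinuousMap.one_apply, ciSup_const] at this
    linarith
  let Λ : CompactlySupportedContinuousMap X ℝ →ₚ[ℝ] ℝ := PositiveLinearMap.mk₀
    { toFun := fun f => T f.toContinuousMap
      map_add' := fun f g => T.map_add f.toContinuousMap g.toContinuousMap
      map_smul' := fun c f => T.map_smul c f.toContinuousMap }
    fun f hf => hTpos _ hf
  have hint : ∀ g : C(X, ℝ), ∫ x, g x ∂(RealRMK.rieszMeasure Λ) = T g := fun g =>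
    RealRMK.integral_rieszMeasure Λ (CompactlySupportedContinuousMap.continuousMapEquiv g)
  refine ⟨RealRMK.rieszMeasure Λ, ⟨?_⟩, fun v => ?_⟩
  · have := (hint 1).trans hT1
    simp only [ContinuousMap.one_apply, integral_const, smul_eq_mul, mul_one] at this
    exact (ENNReal.toReal_eq_one_iff _).1 this
  · rw [hint]
    exact (hT ⟨A v, v, rfl⟩).trans (hφσ v)

/-- Finite measures on a finite product agree if they agree on measurable boxes. -/
theorem MeasureTheory.Measure.ext_of_pi_univ {ι : Type*} [Finite ι] {α : ι → Type*}
    [∀ i, MeasurableSpace (α i)] {μ ν : Measure (∀ i, α i)} [IsFiniteMeasure μ]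
    (h : ∀ F : ∀ i, Set (α i), (∀ i, MeasurableSet (F i)) →
      μ (Set.pi Set.univ F) = ν (Set.pi Set.univ F)) : μ = ν := by
  refine ext_of_generate_finite _ generateFrom_pi.symm isPiSystem_pi ?_ ?_
  · rintro _ ⟨F, hF, rfl⟩
    exact h F fun i => hF i (Set.mem_univ i)
  · simpa using h (fun _ => Set.univ) fun _ => MeasurableSet.univ

/-! ### LHV models as joint distributions over all settings -/

namespace CorrelationScenario

variable {N : ℕ} {S : Fin N → ℕ} {Λ : Fin N → Type} [∀ n, MeasurableSpace (Λ n)]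

theorem measurable_select (s : ∀ n, Fin (S n)) :
    Measurable fun (q : ∀ n, Fin (S n) → Λ n) n => q n (s n) := by fun_prop

/-- Conditionally on `ω`, the outcomes of all settings at all sites are drawn independently;
averaging over `ν` gives the joint measure. -/
theorem AdmitsLHV.exists_joint {E : CorrelationScenario S Λ} (hE : E.AdmitsLHV) :
    ∃ μ : Measure (∀ n, Fin (S n) → Λ n), IsProbabilityMeasure μ ∧
      ∀ s, μ.map (fun q n => q n (s n)) = E.P s := by
  obtain ⟨Ω, _, ν, κ, _, hκ, hP⟩ := hE
  let J : Ω → Measure (∀ n, Fin (S n) → Λ n) := fun ω =>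
    Measure.pi fun n => Measure.pi fun t => κ n t ω
  have hbox : ∀ ω (G : ∀ n, Fin (S n) → Set (Λ n)),
      J ω (Set.pi Set.univ fun n => Set.pi Set.univ (G n)) = ∏ n, ∏ t, κ n t ω (G n t) :=
    fun ω G => by simp [J, Measure.pi_pi]
  -- Measurability is tested on the π-system of boxes of boxes, where `J` is a finite product of
  -- measurable functions.
  have hJ : Measurable J := by
    refine Measurable.measure_of_isPiSystem_of_isProbabilityMeasure
      (S := Set.pi Set.univ '' Set.pi Set.univ fun n =>
        Set.pi Set.univ '' Set.pi Set.univ fun _ => {s : Set (Λ n) | MeasurableSet s}) ?_ ?_ ?_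
    · refine (generateFrom_eq_pi (fun n => generateFrom_pi) fun n =>
        ⟨fun _ => Set.univ, fun _ => ⟨fun _ => Set.univ, by simp, by simp⟩,
          Set.iUnion_const _⟩).symm
    · exact IsPiSystem.pi fun n => isPiSystem_pi
    · rintro _ ⟨F, hF, rfl⟩
      choose G hG hGF using fun n => hF n (Set.mem_univ n)
      obtain rfl : (fun n => Set.pi Set.univ (G n)) = F := funext hGF
      simp_rw [hbox]
      exact Finset.measurable_prod _ fun n _ => Finset.measurable_prod _ fun t _ =>
        (κ n t).measurable_coe (hG n t (Set.mem_univ t))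
  have hμ : IsProbabilityMeasure (ν.bind J) := by
    refine ⟨?_⟩
    rw [Measure.bind_apply MeasurableSet.univ hJ.aemeasurable]
    simp [J]
  refine ⟨ν.bind J, hμ, fun s => ?_⟩
  have := Measure.isFiniteMeasure_map (ν.bind J) fun (q : ∀ n, Fin (S n) → Λ n) n => q n (s n)
  refine Measure.ext_of_pi_univ fun F hF => ?_
  have hm := MeasurableSet.univ_pi hF
  rw [Measure.map_apply (measurable_select s) hm, hP s F hF,
    Measure.bind_apply (measurable_select s hm) hJ.aemeasurable]
  refine lintegral_congr fun ω => ?_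
  -- The settings not selected by `s` are unconstrained; each contributes a factor 1, the kernels
  -- being Markov.
  have hset : (fun (q : ∀ n, Fin (S n) → Λ n) n => q n (s n)) ⁻¹' Set.pi Set.univ F =
      Set.pi Set.univ fun n => Set.pi Set.univ fun t => if t = s n then F n else Set.univ := by
    ext q
    simp only [Set.mem_preimage, Set.mem_pi, Set.mem_univ, forall_const]
    refine forall_congr' fun n => ⟨fun h t => ?_, fun h => by simpa using h (s n)⟩
    split_ifs with ht
    · exact ht ▸ h
    · trivial
  rw [hset, hbox]
  refine Finset.prod_congr rfl fun n _ => ?_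
  rw [Finset.prod_eq_single (s n) (fun t _ ht => by simp [ht]) (by simp)]
  simp

/-- A probability measure on a space `X` of hidden variables together with measurable deterministic
responses gives an LHV model. -/
theorem AdmitsLHV.of_deterministic {E : CorrelationScenario S Λ} {X : Type} [MeasurableSpace X]
    (μ : Measure X) [IsProbabilityMeasure μ] (r : ∀ n, Fin (S n) → X → Λ n)
    (hr : ∀ n t, Measurable (r n t)) (h : ∀ s, μ.map (fun x n => r n (s n) x) = E.P s) :
    E.AdmitsLHV := by
  refine ⟨X, inferInstance, μ, fun n t => Kernel.deterministic (r n t) (hr n t), inferInstance,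
    fun _ _ => inferInstance, fun s F hF => ?_⟩
  have hm : Measurable fun x n => r n (s n) x := measurable_pi_lambda _ fun n => hr n (s n)
  rw [← h s, Measure.map_apply hm (MeasurableSet.univ_pi hF),
    ← lintegral_indicator_one (hm (MeasurableSet.univ_pi hF))]
  refine lintegral_congr fun x => ?_
  simp_rw [Kernel.deterministic_apply' (hr _ _) x (hF _)]
  classical
  rw [Set.indicator_apply]
  split_ifs with hx
  · exact (Finset.prod_eq_one fun n _ => by simpa using hx n (Set.mem_univ n)).symm
  · obtain ⟨n, hn⟩ : ∃ n, r n (s n) x ∉ F n := by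
      by_contra! hc
      exact hx fun n _ => hc n
    exact (Finset.prod_eq_zero (Finset.mem_univ n) (by simpa using hn)).symm

/-- With at least one setting per site there is some probability measure on the outcomes. The
separation argument needs this for a deterministic assignment to exist and for a default value of
the inverse embeddings. -/
theorem nonempty_outcome (E : CorrelationScenario S Λ) (hS : ∀ n, 1 ≤ S n) (n : Fin N) :
    Nonempty (Λ n) := by
  have := E.isProbabilityMeasure fun m => ⟨0, hS m⟩
  exact (nonempty_of_isProbabilityMeasure (E.P fun m => ⟨0, hS m⟩)).map fun l => l n

/-- A scenario that satisfies every linear inequality valid for all deterministic assignments of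
outcomes admits an LHV model. -/
theorem admitsLHV_of_value_le [∀ n, StandardBorelSpace (Λ n)] (hS : ∀ n, 1 ≤ S n)
    (E : CorrelationScenario S Λ)
    (h : ∀ (Ψ : BellFamily S Λ) (B : ℝ),
      (∀ q : ∀ n, Fin (S n) → Λ n, ∑ s, Ψ.ψ s (fun n => q n (s n)) ≤ B) → Ψ.value E ≤ B) :
    E.AdmitsLHV := by
  have := E.isProbabilityMeasure
  have hne := E.nonempty_outcome hS
  -- Standard Borel spaces embed measurably into the unit interval, which supplies the compactness
  -- that the outcome spaces lack.
  let e : ∀ n, Λ n → unitInterval := fun n => unitInterval.sigmoid ∘ embeddingReal (Λ n)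
  have he : ∀ n, MeasurableEmbedding (e n) := fun n =>
    measurableEmbedding_sigmoid_comp_embeddingReal (Λ n)
  let X := ∀ n, Fin (S n) → unitInterval
  let K := Fin N → unitInterval
  let π : (∀ n, Fin (S n)) → C(X, K) := fun s => ⟨fun x n => x n (s n), by fun_prop⟩
  let ε : (∀ n, Λ n) → K := fun l n => e n (l n)
  have hε : Measurable ε := measurable_pi_lambda _ fun n =>
    (he n).measurable.comp (measurable_pi_apply n)
  have hbd : ∀ (f : C(K, ℝ)) l, ‖f (ε l)‖ ≤ ‖f‖ := fun f l => f.norm_coe_le_norm _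
  have hint : ∀ s (f : C(K, ℝ)), Integrable (fun l => f (ε l)) (E.P s) := fun s f =>
    Integrable.of_bound (f.continuous.measurable.comp hε).aestronglyMeasurable ‖f‖
      (.of_forall (hbd f))
  let A : ((∀ n, Fin (S n)) → C(K, ℝ)) →ₗ[ℝ] C(X, ℝ) :=
    { toFun := fun f => ∑ s, (f s).comp (π s)
      map_add' := fun f g => by
        ext x; simp [Finset.sum_add_distrib]
      map_smul' := fun c f => by
        ext x; simp [Finset.mul_sum] }
  have hA : ∀ f x, A f x = ∑ s, f s (π s x) := fun f x => by simp [A]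
  let φ : ((∀ n, Fin (S n)) → C(K, ℝ)) →ₗ[ℝ] ℝ :=
    { toFun := fun f => ∑ s, ∫ l, f s (ε l) ∂(E.P s)
      map_add' := fun f g => by
        rw [← Finset.sum_add_distrib]
        exact Finset.sum_congr rfl fun s _ => integral_add (hint s (f s)) (hint s (g s))
      map_smul' := fun c f => by
        simp [integral_const_mul, Finset.mul_sum] }
  obtain ⟨μ, hμ, hμφ⟩ := exists_isProbabilityMeasure_of_le_sup
    (fun (q : ∀ n, Fin (S n) → Λ n) n t => e n (q n t)) A φ fun f B hB =>
      h ⟨fun s l => f s (ε l), fun s => (f s).continuous.measurable.comp hε,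
        fun s => ⟨‖f s‖, hbd (f s)⟩⟩ B fun q => (hA f _).symm.trans_le (hB q)
  -- Testing with a function placed at the single joint setting `s` isolates that marginal.
  have hmap : ∀ s, μ.map (π s) = (E.P s).map ε := fun s => by
    have := Measure.isFiniteMeasure_map μ (π s)
    have := Measure.isFiniteMeasure_map (E.P s) ε
    refine ext_of_forall_integral_eq_of_IsFiniteMeasure fun f => ?_
    have := hμφ (Pi.single s f.toContinuousMap)
    simp_rw [hA] at this
    have key : ∀ k : (∀ n, Fin (S n)) → K,
        ∑ t, (Pi.single s f.toContinuousMap : _ → C(K, ℝ)) t (k t) = f (k s) := fun k => by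
      rw [Finset.sum_eq_single s (fun t _ ht => by simp [ht]) (by simp)]
      simp
    rw [integral_map (π s).continuous.measurable.aemeasurable
        f.continuous.aestronglyMeasurable,
      integral_map hε.aemeasurable f.continuous.aestronglyMeasurable]
    simp_rw [key] at this
    rw [this]
    change ∑ t, _ = _
    rw [Finset.sum_eq_single s (fun t _ ht => by simp [ht]) (by simp)]
    simp
  -- `μ` lives on the compactification, so its points are pulled back by the measurable inverses.
  -- The values chosen off the image do not matter: each marginal of `μ` is a pushforward under `ε`.
  refine AdmitsLHV.of_deterministic μ (fun n t x => (he n).invFun (x n t))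
    (fun n t => (he n).measurable_invFun.comp (by fun_prop)) fun s => ?_
  have hinv : Measurable fun (k : K) n => (he n).invFun (k n) := measurable_pi_lambda _ fun n =>
    (he n).measurable_invFun.comp (measurable_pi_apply n)
  calc μ.map (fun x n => (he n).invFun (x n (s n)))
      = (μ.map (π s)).map fun k n => (he n).invFun (k n) :=
        (Measure.map_map hinv (π s).continuous.measurable).symm
    _ = (E.P s).map ((fun (k : K) n => (he n).invFun (k n)) ∘ ε) := by
        rw [hmap, Measure.map_map hinv hε]
    _ = E.P s := by
        have : (fun (k : K) n => (he n).invFun (k n)) ∘ ε = id := by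
          funext l n
          exact (he n).leftInverse_invFun (l n)
        rw [this, Measure.map_id]

end CorrelationScenario


/-! ### Signed simulating measures and tight LHV bounds -/

namespace CorrelationScenario

variable {N : ℕ} {S : Fin N → ℕ} {Λ : Fin N → Type} [∀ n, MeasurableSpace (Λ n)]

/-- Positive minus negative mass is 1, so the positive part alone has mass at least 1. -/
theorem one_le_gamma (E : CorrelationScenario S Λ) : 1 ≤ E.gamma := by
  refine le_iInf₂ fun μ hμ => ?_
  have h := hμ.1
  rw [SignedMeasure.apply_eq_posPart_real_sub_negPart_real _ MeasurableSet.univ] at h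
  have hneg := measureReal_nonneg (μ := μ.toJordanDecomposition.negPart) (s := Set.univ)
  have hpos : 1 ≤ μ.toJordanDecomposition.posPart.real Set.univ := by linarith
  refine le_trans ?_ (le_self_add : μ.toJordanDecomposition.posPart Set.univ ≤ _)
  rw [← ofReal_measureReal, ← ENNReal.ofReal_one]
  exact ENNReal.ofReal_le_ofReal hpos

theorem AdmitsLHV.gamma_eq_one {E : CorrelationScenario S Λ} (hE : E.AdmitsLHV) :
    E.gamma = 1 := by
  refine le_antisymm ?_ E.one_le_gamma
  obtain ⟨μ, _, hμ⟩ := hE.exists_joint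
  let j : JordanDecomposition (∀ n, Fin (S n) → Λ n) :=
    { posPart := μ
      negPart := 0
      mutuallySingular := Measure.MutuallySingular.zero_right }
  have hj : E.IsSimulatedBy j.toSignedMeasure := by
    refine ⟨?_, fun s F hF => ?_⟩
    · rw [JordanDecomposition.toSignedMeasure, Measure.toSignedMeasure_sub_apply MeasurableSet.univ]
      simp [j]
    · have hF' := measurable_select s hF
      rw [JordanDecomposition.toSignedMeasure, Measure.toSignedMeasure_sub_apply hF', ← hμ s,
        map_measureReal_apply (measurable_select s) hF]
      simp [j]
  refine (iInf₂_le _ hj).trans ?_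
  rw [SignedMeasure.totalVariation, JordanDecomposition.toJordanDecomposition_toSignedMeasure]
  simp [j]

theorem _root_.BellFamily.integrable_select (Ψ : BellFamily S Λ) (s : ∀ n, Fin (S n))
    (ν : Measure (∀ n, Fin (S n) → Λ n)) [IsFiniteMeasure ν] :
    Integrable (fun q : ∀ n, Fin (S n) → Λ n => Ψ.ψ s fun n => q n (s n)) ν := by
  obtain ⟨D, hD⟩ := Ψ.bounded s
  exact Integrable.of_bound ((Ψ.measurable s).comp (measurable_select s)).aestronglyMeasurable D
    (.of_forall fun q => hD _)

/-- If a scenario is simulated by a signed measure `μ`, then its averages exceed a bound valid for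
all deterministic assignments at most by a multiple of the mass of the negative part of `μ`. -/
theorem IsSimulatedBy.value_le {E : CorrelationScenario S Λ}
    {μ : SignedMeasure (∀ n, Fin (S n) → Λ n)} (hμ : E.IsSimulatedBy μ) (Ψ : BellFamily S Λ)
    {B C : ℝ} (hB : ∀ q : ∀ n, Fin (S n) → Λ n, ∑ s, Ψ.ψ s (fun n => q n (s n)) ≤ B)
    (hC : ∀ q : ∀ n, Fin (S n) → Λ n, -C ≤ ∑ s, Ψ.ψ s (fun n => q n (s n))) :
    Ψ.value E ≤ B + (B + C) * μ.toJordanDecomposition.negPart.real Set.univ := by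
  have := E.isProbabilityMeasure
  set p := μ.toJordanDecomposition.posPart with hp
  set m := μ.toJordanDecomposition.negPart with hm
  have hint : ∀ (ν : Measure (∀ n, Fin (S n) → Λ n)) [IsFiniteMeasure ν] s,
      Integrable (fun q : ∀ n, Fin (S n) → Λ n => Ψ.ψ s fun n => q n (s n)) ν :=
    fun ν _ s => Ψ.integrable_select s ν
  have hone : p.real Set.univ = 1 + m.real Set.univ := by
    have h := hμ.1
    rw [SignedMeasure.apply_eq_posPart_real_sub_negPart_real _ MeasurableSet.univ] at h
    linarith
  -- The signed marginal condition, rearranged into an identity of positive measures that can be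
  -- integrated term by term.
  have hmeas : ∀ s, E.P s + m.map (fun q n => q n (s n)) = p.map fun q n => q n (s n) := fun s => by
    have := Measure.isFiniteMeasure_map p fun (q : ∀ n, Fin (S n) → Λ n) n => q n (s n)
    have := Measure.isFiniteMeasure_map m fun (q : ∀ n, Fin (S n) → Λ n) n => q n (s n)
    refine Measure.ext fun F hF => ?_
    rw [← measureReal_eq_measureReal_iff, measureReal_add_apply,
      map_measureReal_apply (measurable_select s) hF, map_measureReal_apply (measurable_select s) hF]
    have h := hμ.2 s F hF
    rw [SignedMeasure.apply_eq_posPart_real_sub_negPart_real _ (measurable_select s hF)] at h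
    linarith
  have hval : ∀ s, ∫ l, Ψ.ψ s l ∂(E.P s) =
      ∫ q, Ψ.ψ s (fun n => q n (s n)) ∂p - ∫ q, Ψ.ψ s (fun n => q n (s n)) ∂m := fun s => by
    obtain ⟨D, hD⟩ := Ψ.bounded s
    have hmap : ∀ ν : Measure (∀ n, Fin (S n) → Λ n),
        ∫ l, Ψ.ψ s l ∂(ν.map fun q n => q n (s n)) = ∫ q, Ψ.ψ s (fun n => q n (s n)) ∂ν :=
      fun ν => integral_map (measurable_select s).aemeasurable
        (Ψ.measurable s).aestronglyMeasurable
    have := Measure.isFiniteMeasure_map m fun (q : ∀ n, Fin (S n) → Λ n) n => q n (s n)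
    rw [← hmap p, ← hmap m, ← hmeas s, integral_add_measure, add_sub_cancel_right]
    all_goals exact Integrable.of_bound (Ψ.measurable s).aestronglyMeasurable D (.of_forall hD)
  have hup : ∫ q, ∑ s, Ψ.ψ s (fun n => q n (s n)) ∂p ≤ p.real Set.univ * B := by
    refine (integral_mono (integrable_finsetSum _ fun s _ => hint p s)
      (integrable_const B) hB).trans_eq (by simp)
  have hlow : m.real Set.univ * -C ≤ ∫ q, ∑ s, Ψ.ψ s (fun n => q n (s n)) ∂m := by
    refine (by simp : m.real Set.univ * -C = ∫ _, -C ∂m).trans_le (integral_mono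
      (integrable_const _) (integrable_finsetSum _ fun s _ => hint m s) hC)
  have : Ψ.value E = ∫ q, ∑ s, Ψ.ψ s (fun n => q n (s n)) ∂p -
      ∫ q, ∑ s, Ψ.ψ s (fun n => q n (s n)) ∂m := by
    rw [integral_finsetSum _ fun s _ => hint p s, integral_finsetSum _ fun s _ => hint m s,
      ← Finset.sum_sub_distrib]
    exact Finset.sum_congr rfl fun s _ => hval s
  rw [this]
  rw [hone] at hup
  linarith

theorem _root_.BellFamily.exists_abs_sum_le (Ψ : BellFamily S Λ) :
    ∃ C, 0 ≤ C ∧ ∀ l : (∀ n, Fin (S n)) → ∀ n, Λ n, |∑ s, Ψ.ψ s (l s)| ≤ C := by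
  choose D hD using Ψ.bounded
  exact ⟨∑ s, |D s|, by positivity, fun l => (Finset.abs_sum_le_sum_abs _ _).trans
    (Finset.sum_le_sum fun s _ => (hD s _).trans (le_abs_self _))⟩

/-- A scenario with `γ ≤ 1` admits an LHV model, although the infimum defining `γ` is not assumed to
be attained. -/
theorem admitsLHV_of_gamma_le_one [∀ n, StandardBorelSpace (Λ n)] (hS : ∀ n, 1 ≤ S n)
    {E : CorrelationScenario S Λ} (hE : E.gamma ≤ 1) : E.AdmitsLHV := by
  refine E.admitsLHV_of_value_le hS fun Ψ B hB => le_of_forall_pos_le_add fun δ hδ => ?_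
  obtain ⟨C, hC0, hC⟩ := Ψ.exists_abs_sum_le
  -- With `t` the negative mass, the total variation is `1 + 2 * t`, so `t` is at most this quantity
  -- and the error `(B + C) * t` at most `δ`. The summand 1 keeps the denominator positive.
  have hε : 0 < δ / (|B| + C + 1) := by positivity
  have hlt : E.gamma < 1 + ENNReal.ofReal (δ / (|B| + C + 1)) := hE.trans_lt
    (ENNReal.lt_add_right ENNReal.one_ne_top (ENNReal.ofReal_pos.2 hε).ne')
  obtain ⟨μ, hlt⟩ := iInf_lt_iff.1 hlt
  obtain ⟨hμ, hlt⟩ := iInf_lt_iff.1 hlt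
  have hv := hμ.value_le Ψ hB (C := C) fun q => (abs_le.1 (hC _)).1
  set t := μ.toJordanDecomposition.negPart.real Set.univ with ht
  have ht0 : 0 ≤ t := measureReal_nonneg
  have hone := hμ.1
  rw [SignedMeasure.apply_eq_posPart_real_sub_negPart_real _ MeasurableSet.univ] at hone
  have htv : t ≤ δ / (|B| + C + 1) := by
    rw [SignedMeasure.totalVariation, Measure.add_apply, ← ofReal_measureReal (s := Set.univ),
      ← ofReal_measureReal (s := Set.univ), ← ENNReal.ofReal_add measureReal_nonneg ht0,
      ← ENNReal.ofReal_one, ← ENNReal.ofReal_add zero_le_one hε.le,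
      ENNReal.ofReal_lt_ofReal_iff (by positivity)] at hlt
    linarith
  refine hv.trans (add_le_add_right ?_ B)
  have : (B + C) * t ≤ (|B| + C + 1) * (δ / (|B| + C + 1)) :=
    mul_le_mul (by linarith [le_abs_self B]) htv ht0 (by positivity)
  rwa [mul_div_cancel₀ _ (by positivity)] at this

/-- The value is an average of deterministic values over the joint measure. -/
theorem AdmitsLHV.value_le {E : CorrelationScenario S Λ} (hE : E.AdmitsLHV) (Ψ : BellFamily S Λ)
    {B : ℝ} (hB : ∀ q : ∀ n, Fin (S n) → Λ n, ∑ s, Ψ.ψ s (fun n => q n (s n)) ≤ B) :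
    Ψ.value E ≤ B := by
  obtain ⟨μ, _, hμ⟩ := hE.exists_joint
  have hval : Ψ.value E = ∫ q, ∑ s, Ψ.ψ s (fun n => q n (s n)) ∂μ := by
    rw [integral_finsetSum _ fun s _ => Ψ.integrable_select s μ]
    refine Finset.sum_congr rfl fun s _ => ?_
    rw [← hμ s, integral_map (measurable_select s).aemeasurable
      (Ψ.measurable s).aestronglyMeasurable]
  rw [hval]
  exact (integral_mono (integrable_finsetSum _ fun s _ => Ψ.integrable_select s μ)
    (integrable_const B) hB).trans_eq (by simp)

/-- Constant outcomes suffice. Nonemptiness is what lets a common bound on LHV values bound the real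
supremum `lhvSup`. -/
theorem exists_admitsLHV (hΛ : ∀ n, Nonempty (Λ n)) :
    ∃ E : CorrelationScenario S Λ, E.AdmitsLHV := by
  let l : ∀ n, Λ n := fun n => (hΛ n).some
  refine ⟨⟨fun _ => .dirac l, fun _ => inferInstance⟩, ?_⟩
  exact AdmitsLHV.of_deterministic (Measure.dirac ()) (fun n _ _ => l n)
    (fun _ _ => measurable_const) fun s => Measure.map_dirac' measurable_const _

/-- The tight LHV constraints characterize the scenarios admitting an LHV model. -/
theorem admitsLHV_of_value_le_lhvSup [∀ n, StandardBorelSpace (Λ n)] (hS : ∀ n, 1 ≤ S n)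
    {E : CorrelationScenario S Λ} (hE : ∀ Ψ : BellFamily S Λ, Ψ.value E ≤ Ψ.lhvSup) :
    E.AdmitsLHV := by
  refine E.admitsLHV_of_value_le hS fun Ψ B hB => (hE Ψ).trans (csSup_le ?_ ?_)
  · obtain ⟨E', hE'⟩ := exists_admitsLHV (S := S) (E.nonempty_outcome hS)
    exact ⟨_, E', hE', rfl⟩
  · rintro _ ⟨E', hE', rfl⟩
    exact AdmitsLHV.value_le hE' Ψ hB

/-- Keeps the LHV values bounded, so that `lhvSup` and `lhvInf` are genuine bounds and not the
default values of unbounded sets. -/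
theorem _root_.BellFamily.exists_abs_value_le (Ψ : BellFamily S Λ) :
    ∃ C, ∀ E : CorrelationScenario S Λ, |Ψ.value E| ≤ C := by
  choose D hD using Ψ.bounded
  refine ⟨∑ s, D s, fun E => (Finset.abs_sum_le_sum_abs _ _).trans
    (Finset.sum_le_sum fun s _ => ?_)⟩
  have := E.isProbabilityMeasure s
  simpa using norm_integral_le_of_norm_le_const (f := Ψ.ψ s) (μ := E.P s) (.of_forall (hD s))

theorem AdmitsLHV.not_isViolatedBy {E : CorrelationScenario S Λ} (hE : E.AdmitsLHV)
    (Ψ : BellFamily S Λ) : ¬ Ψ.IsViolatedBy E := by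
  obtain ⟨C, hC⟩ := Ψ.exists_abs_value_le
  rw [BellFamily.IsViolatedBy, not_not]
  refine ⟨csInf_le ⟨-C, ?_⟩ ⟨E, hE, rfl⟩, le_csSup ⟨C, ?_⟩ ⟨E, hE, rfl⟩⟩
  · rintro _ ⟨E', -, rfl⟩
    exact (abs_le.1 (hC E')).1
  · rintro _ ⟨E', -, rfl⟩
    exact (abs_le.1 (hC E')).2

/-- Reindexing the settings at every site. -/
def reindex {L : Fin N → ℕ} (E : CorrelationScenario L Λ) (c : ∀ n, Fin (S n) → Fin (L n)) :
    CorrelationScenario S Λ :=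
  ⟨fun s => E.P fun n => c n (s n), fun _ => E.isProbabilityMeasure _⟩

/-- Every original setting has a copy among the new ones; the model keeps the kernels of one chosen
copy. -/
theorem AdmitsLHV.of_reindex {L : Fin N → ℕ} {E : CorrelationScenario L Λ}
    {c : ∀ n, Fin (S n) → Fin (L n)} (hc : ∀ n, Function.Surjective (c n))
    (hE : (E.reindex c).AdmitsLHV) : E.AdmitsLHV := by
  obtain ⟨Ω, _, ν, κ, hν, hκ, h⟩ := hE
  choose i hi using hc
  refine ⟨Ω, _, ν, fun n t => κ n (i n t), hν, fun n t => hκ n _, fun s F hF => ?_⟩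
  rw [← h (fun n => i n (s n)) F hF]
  simp [reindex, hi]

end CorrelationScenario

/-! ### Existence of a quantum scenario -/

section TrivialMeasurement

variable {N : ℕ} {H : Fin N → Type u} [∀ n, NormedAddCommGroup (H n)]
    [∀ n, InnerProductSpace ℂ (H n)]

open Classical in
/-- The measurement with a certain outcome. -/
noncomputable def POVM.dirac {Λ : Type} [MeasurableSpace Λ] (a : Λ) (E : Type u)
    [NormedAddCommGroup E] [InnerProductSpace ℂ E] : POVM Λ E where
  toFun F := if a ∈ F then 1 else 0
  isPositive F _ := by
    split_ifs
    · exact ContinuousLinearMap.isPositive_one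
    · exact ContinuousLinearMap.isPositive_zero
  map_univ := by simp
  hasSum_iUnion F _ hd x := by
    by_cases h : ∃ k, a ∈ F k
    · obtain ⟨k, hk⟩ := h
      have hne : ∀ k' ≠ k, a ∉ F k' := fun k' hk' ha =>
        Set.disjoint_left.1 (hd hk') ha hk
      rw [if_pos (Set.mem_iUnion.2 ⟨k, hk⟩)]
      have := hasSum_single (f := fun k => (if a ∈ F k then (1 : E →L[ℂ] E) else 0) x) k
        fun k' hk' => by simp [hne k' hk']
      simpa [hk] using this
    · rw [if_neg (by simpa using h)]
      push Not at h
      simp [h, hasSum_zero]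

/-- Elementary tensors span a dense subspace of the completion. -/
theorem HilbertTensor.continuousLinearMap_ext {T U : HilbertTensor H →L[ℂ] HilbertTensor H}
    (h : ∀ x : ∀ n, H n, T (AlgTensor.pure x : AlgTensor H) = U (AlgTensor.pure x : AlgTensor H)) :
    T = U := by
  refine ContinuousLinearMap.ext fun t => ?_
  induction t using UniformSpace.Completion.induction_on with
  | hp => exact isClosed_eq T.continuous U.continuous
  | ih t =>
    induction t using AlgTensor.induction_pure with
    | h0 => rw [UniformSpace.Completion.coe_zero, map_zero, map_zero]
    | hp x => exact h x
    | ha s t hs ht => rw [UniformSpace.Completion.coe_add, map_add, map_add, hs, ht]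
    | hs c t ht => rw [UniformSpace.Completion.coe_smul, map_smul, map_smul, ht]

variable [∀ n, CompleteSpace (H n)]

theorem tensorOp_one : tensorOp (H := H) (fun _ => 1) = 1 :=
  HilbertTensor.continuousLinearMap_ext fun x => tensorOp_pure _ x

theorem tensorOp_eq_zero {X : ∀ n, H n →L[ℂ] H n} {n : Fin N} (hn : X n = 0) :
    tensorOp X = 0 :=
  HilbertTensor.continuousLinearMap_ext fun x => by
    rw [tensorOp_pure]
    have : (AlgTensor.pure fun n => X n (x n) : AlgTensor H) = 0 :=
      (PiTensorProduct.tprod ℂ).map_coord_zero n (by simp [hn])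
    simp [this]

/-- An empty supremum in `ℝ≥0∞` is 0, so `1 ≤ upsilon ρ S` requires some quantum scenario. For the
trivial measurement the tensor operator is 1 or 0, with trace against `ρ` equal to 1 or 0. -/
theorem IsState.exists_isQuantum {ρ : HilbertTensor H →L[ℂ] HilbertTensor H} (hρ : IsState ρ)
    (S : Fin N → ℕ) : ∃ (M : ∀ n, Fin (S n) → POVM Unit (H n))
      (E : CorrelationScenario S fun _ => Unit), E.IsQuantum ρ M := by
  classical
  refine ⟨fun n _ => POVM.dirac () (H n), ⟨fun _ => .dirac fun _ => (), fun _ => inferInstance⟩,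
    fun s F hF => ?_⟩
  have hm := MeasurableSet.univ_pi hF
  by_cases h : ∀ n, () ∈ F n
  · have h1 : (fun n => (POVM.dirac () (H n)).toFun (F n)) = fun _ => 1 :=
      funext fun n => if_pos (h n)
    have h2 : (Measure.dirac fun _ : Fin N => ()).real (Set.pi Set.univ F) = 1 := by
      rw [measureReal_def, Measure.dirac_apply' _ hm, Set.indicator_of_mem (by simpa using h)]
      simp
    rw [h1, h2, tensorOp_one]
    rw [ContinuousLinearMap.one_def, ContinuousLinearMap.comp_id]
    simpa using hρ.hasTrace
  · push Not at h
    obtain ⟨n, hn⟩ := h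
    have h2 : (Measure.dirac fun _ : Fin N => ()).real (Set.pi Set.univ F) = 0 := by
      rw [measureReal_def, Measure.dirac_apply' _ hm,
        Set.indicator_of_notMem fun h => hn (Set.mem_univ_pi.1 h n)]
      simp
    rw [tensorOp_eq_zero (n := n) (if_neg hn), h2]
    intro ι b
    simp [hasSum_zero]

end TrivialMeasurement

/-! ### The equivalences -/

theorem proposition6 {N : ℕ} {H : Fin N → Type u} [∀ n, NormedAddCommGroup (H n)]
    [∀ n, InnerProductSpace ℂ (H n)] [∀ n, CompleteSpace (H n)]
    [∀ n, TopologicalSpace.SeparableSpace (H n)]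
    (ρ : HilbertTensor H →L[ℂ] HilbertTensor H) (hρ : IsState ρ)
    (S : Fin N → ℕ) (hS : ∀ n, 1 ≤ S n) :
    [AdmitsLHVDescription ρ S, upsilon ρ S = 1, ¬ ViolatesBellType ρ S].TFAE := by
  tfae_have 1 → 2 := fun h => by
    refine le_antisymm ?_ ?_
    · exact iSup_le fun Λ => iSup_le fun _ => iSup_le fun _ => iSup_le fun M => iSup_le fun E =>
        iSup_le fun hE => (h Λ M E hE).gamma_eq_one.le
    · obtain ⟨M, E, hE⟩ := hρ.exists_isQuantum S
      exact E.one_le_gamma.trans <| le_iSup_of_le (fun _ => Unit) <|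
        le_iSup_of_le (fun _ => inferInstance) <| le_iSup_of_le (fun _ => inferInstance) <|
        le_iSup_of_le M <| le_iSup_of_le E <| le_iSup_of_le hE le_rfl
  tfae_have 2 → 1 := fun h Λ _ _ M E hE => by
    refine CorrelationScenario.admitsLHV_of_gamma_le_one hS (le_trans ?_ h.le)
    exact le_iSup_of_le Λ <| le_iSup_of_le inferInstance <| le_iSup_of_le inferInstance <|
      le_iSup_of_le M <| le_iSup_of_le E <| le_iSup_of_le hE le_rfl
  tfae_have 1 → 3 := by
    rintro h ⟨L, hL, Λ, _, _, Ψ, M, E, -, hE, hv⟩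
    -- The last of the `L n` settings is repeated: `1 ≤ L n` keeps the index in range, `L n ≤ S n`
    -- makes `c n` surjective.
    let c : ∀ n, Fin (S n) → Fin (L n) := fun n t => ⟨min t (L n - 1), by have := hL n; omega⟩
    have hc : ∀ n, Function.Surjective (c n) := fun n t =>
      ⟨⟨t, t.2.trans_le (hL n).2⟩, Fin.ext (by simp only [c]; omega)⟩
    exact (CorrelationScenario.AdmitsLHV.of_reindex hc <| h Λ (fun n t => M n (c n t))
      (E.reindex c) fun s F hF => hE (fun n => c n (s n)) F hF).not_isViolatedBy Ψ hv
  tfae_have 3 → 1 := fun h Λ _ _ M E hE => by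
    by_contra hn
    refine hn (CorrelationScenario.admitsLHV_of_value_le_lhvSup hS fun Ψ => ?_)
    by_contra hlt
    -- Exceeding the upper bound is already a violation, and the non-LHV scenario `E` itself
    -- certifies that the constraint is of Bell type.
    have hv : Ψ.IsViolatedBy E := fun hv => hlt hv.2
    exact h ⟨S, fun n => ⟨hS n, le_rfl⟩, Λ, _, inferInstance, Ψ, M, E, ⟨E, hn, hv⟩, hE, hv⟩
  tfae_finish
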